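/- Let $X$ and $Y$ be finite-dimensional real Hilbert spaces (for instance $X=\mathbb R^n$, $Y=\mathbb R^m$). Consider the problem $$\text{(P)}\qquad \min_{x\in X}\ \Phi(x):=f(x)+g(c(x)),$$ where $f:X\to\mathbb R$ is continuously differentiable and convex, $g:Y\to\mathbb R\cup\{+\infty\}$ is proper, lower semicontinuous (lsc) and convex, $c:X\to Y$ is continuously differentiable and satisfies $$c(\lambda x+(1-\lambda)x')-\lambda c(x)-(1-\lambda)c(x')\in \operatorname{hzn} g\qquad\text{for all }x,x'\in X,\ \lambda\in[0,1],$$ with $\operatorname{hzn} g:=\{v\in Y\mid g(z+v)\le g(z)\ \text{for all } z\in\operatorname{dom} g\}$, and (P) is feasible and possesses a minimizer. Assume that the value function $\mathcal V(u):=\inf_{x}\{f(x)+g(c(x)-u)\}$, $u\in Y$, is proper and lsc. Define $$\mathcal L(x,y):=f(x)+\inf_z\{g(z)+\langle y,c(x)-z\rangle\},\qquad \mathcal M(y):=\inf_x\mathcal L(x,y),$$ $$\mathcal L_\mu(x,y):=f(x)+\inf_z\Big\{g(z)+\langle y,c(x)-z\rangle+\tfrac1{2\mu}\|c(x)-z\|^2\Big\}\qquad(\mu>0).$$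 Let $Y_{\rm sg}\subseteq Y$ be nonempty, convex and compact, $\beta\in(0,1)$, $\mu_0>0$, $y^0\in Y$, and let $\{(x^k,z^k,y^k,\hat y^k)\}$, together with $\varepsilon_k\ge 0$ and $\{\mu_k\}$, be generated by the safeguarded augmented Lagrangian method: for $k=0,1,2,\dots$, - $\hat y^k=\Pi_{Y_{\rm sg}}(y^k)$ (the projection of $y^k$ onto $Y_{\rm sg}$); - $x^k$ satisfies $\mathcal L_{\mu_k}(x^k,\hat y^k)\le\inf_x\mathcal L_{\mu_k}(x,\hat y^k)+\varepsilon_k$; - $z^k=\operatorname{prox}_{\mu_k g}(c(x^k)+\mu_k\hat y^k)$, i.e. $z^k$ is the minimizer of $v\mapsto g(v)+\frac1{2\mu_k}\|v-c(x^k)-\mu_k\hat y^k\|^2$; - $y^{k+1}=\hat y^k+\mu_k^{-1}[c(x^k)-z^k]$; - $\mu_{k+1}=\beta_k\mu_k$ for some $\beta_k\in(0,\beta]\cup\{1\}$. Assume that $\sum_{k=0}^\infty\sqrt{\varepsilon_k/\mu_k}<\infty$. Then $$\sum_{k=0}^\infty\mu_k\|y^{k+1}-y^k\|^2<\infty,\qquad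 \sum_{k=0}^\infty\mu_k\|\hat y^{k+1}-\hat y^k\|^2<\infty,$$ and $\mu_k(y^{k+1}-y^k)\to0$ and $\mu_k(\hat y^{k+1}-\hat y^k)\to0$. Moreover, $\{\mu_k\}$ is nonincreasing and converges to some $\mu\ge0$, the problem $$\text{(D}_\mu)\qquad \min_{y\in Y}\ -\mathcal M(y)+\frac{\mu}{2}\operatorname{dist}^2_{Y_{\rm sg}}(y)$$ is convex, and every accumulation point of $\{y^k\}$ is a solution of (D$_\mu$), i.e. a minimizer of its objective at which the objective is finite. -/

import Mathlib

open Set Filter Topology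

namespace CompositeALM

noncomputable section

/-! Extended-real-valued functions. A function `E → ℝ ∪ {±∞}` is a map `E → EReal`. -/

/-- `φ` is proper: its domain `{φ < ∞}` is nonempty and `φ` never takes the value `-∞`. -/
def Proper {E : Type*} (φ : E → EReal) : Prop :=
  (∃ z, φ z < ⊤) ∧ ∀ z, φ z ≠ ⊥

/-- `φ` is convex: its epigraph `{(z, a) | φ z ≤ a}` is a convex set. -/
def ConvexFun {E : Type*} [AddCommGroup E] [Module ℝ E] (φ : E → EReal) : Prop :=
  Convex ℝ {p : E × ℝ | φ p.1 ≤ (p.2 : EReal)}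

/-- `w` solves the problem of minimizing `φ`: `w` lies in the domain of `φ` and
minimizes `φ` globally. -/
def IsSolution {E : Type*} (φ : E → EReal) (w : E) : Prop :=
  φ w < ⊤ ∧ ∀ v, φ w ≤ φ v

/-- The horizon `{v | ∀ z ∈ dom φ, φ (z + v) ≤ φ z}` of `φ`. -/
def hzn {E : Type*} [AddCommGroup E] (φ : E → EReal) : Set E :=
  {v | ∀ z, φ z < ⊤ → φ (z + v) ≤ φ z}

/-- `w` is the proximal point `prox_{γ φ}(z)`, i.e. the minimizer of
`φ + ‖· - z‖² / (2 γ)` (it is unique when `φ` is proper, lsc, convex and `γ > 0`). -/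
def IsProx {E : Type*} [NormedAddCommGroup E] (γ : ℝ) (φ : E → EReal) (z w : E) : Prop :=
  IsSolution (fun v => φ v + ((‖v - z‖ ^ 2 / (2 * γ) : ℝ) : EReal)) w

/-- `w` is the projection of `z` onto `C`: it lies in `C` and realizes the distance. -/
def IsProjection {E : Type*} [NormedAddCommGroup E] (C : Set E) (z w : E) : Prop :=
  w ∈ C ∧ ‖w - z‖ = Metric.infDist z C

section Problem

variable {X Y : Type*} [NormedAddCommGroup X] [InnerProductSpace ℝ X]
  [NormedAddCommGroup Y] [InnerProductSpace ℝ Y]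

/-- The objective `Φ(x) = f(x) + g(c(x))` of the composite problem (P). -/
def objective (f : X → ℝ) (g : Y → EReal) (c : X → Y) (x : X) : EReal :=
  (f x : EReal) + g (c x)

/-- The standing assumptions on the fully convex composite problem (P). -/
structure FullyConvexComposite (f : X → ℝ) (g : Y → EReal) (c : X → Y) : Prop where
  f_smooth : ContDiff ℝ 1 f
  f_convex : ConvexOn ℝ univ f
  g_proper : Proper g
  g_lsc : LowerSemicontinuous g
  g_convex : ConvexFun g
  c_smooth : ContDiff ℝ 1 c
  /-- `c` is convex with respect to the cone `-hzn g`. -/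
  c_convex : ∀ x x' : X, ∀ t ∈ Icc (0 : ℝ) 1,
    c (t • x + (1 - t) • x') - t • c x - (1 - t) • c x' ∈ hzn g
  /-- (P) is feasible and possesses a minimizer. -/
  exists_solution : ∃ x, IsSolution (objective f g c) x

/-- The value function `V(u) = inf_x f(x) + g(c(x) - u)`. -/
def valueFun (f : X → ℝ) (g : Y → EReal) (c : X → Y) (u : Y) : EReal :=
  ⨅ x : X, ((f x : EReal) + g (c x - u))

/-- The Lagrangian `L(x, y) = f(x) + inf_z { g(z) + ⟨y, c(x) - z⟩ }`. -/
def lagrangian (f : X → ℝ) (g : Y → EReal) (c : X → Y) (x : X) (y : Y) : EReal :=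
  (f x : EReal) + ⨅ z : Y, (g z + ((inner ℝ y (c x - z) : ℝ) : EReal))

/-- The augmented Lagrangian
`L_μ(x, y) = f(x) + inf_z { g(z) + ⟨y, c(x) - z⟩ + ‖c(x) - z‖² / (2 μ) }`. -/
def augLagrangian (f : X → ℝ) (g : Y → EReal) (c : X → Y) (μ : ℝ) (x : X) (y : Y) : EReal :=
  (f x : EReal) +
    ⨅ z : Y, (g z + ((inner ℝ y (c x - z) + ‖c x - z‖ ^ 2 / (2 * μ) : ℝ) : EReal))

/-- The dual objective `M(y) = inf_x L(x, y)`. -/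
def dualFun (f : X → ℝ) (g : Y → EReal) (c : X → Y) (y : Y) : EReal :=
  ⨅ x : X, lagrangian f g c x y

/-- The objective `-M(y) + (μ / 2) dist(y, S)²` (to be minimized) of the penalized dual
problem (D_μ) with safeguarding set `S`. -/
def penalizedDual (f : X → ℝ) (g : Y → EReal) (c : X → Y) (S : Set Y) (μ : ℝ) (y : Y) : EReal :=
  -dualFun f g c y + ((μ / 2 * Metric.infDist y S ^ 2 : ℝ) : EReal)

/-- The sequences are generated by the safeguarded augmented Lagrangian method for (P) with
safeguarding set `S`, reduction factor `β`, penalty parameters `μ k`, inexactness parameters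
`ε k` and starting point `y 0`. -/
structure IsSafeguardedALM (f : X → ℝ) (g : Y → EReal) (c : X → Y) (S : Set Y) (β : ℝ)
    (μ ε : ℕ → ℝ) (x : ℕ → X) (z y yhat : ℕ → Y) : Prop where
  S_nonempty : S.Nonempty
  S_convex : Convex ℝ S
  S_compact : IsCompact S
  β_mem : β ∈ Ioo (0 : ℝ) 1
  μ_zero_pos : 0 < μ 0
  ε_nonneg : ∀ k, 0 ≤ ε k
  yhat_step : ∀ k, IsProjection S (y k) (yhat k)
  /-- `x k` is an `ε k`-minimizer of the augmented Lagrangian subproblem. -/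
  x_step : ∀ k, augLagrangian f g c (μ k) (x k) (yhat k) ≤
    (⨅ x' : X, augLagrangian f g c (μ k) x' (yhat k)) + (ε k : EReal)
  z_step : ∀ k, IsProx (μ k) g (c (x k) + μ k • yhat k) (z k)
  y_step : ∀ k, y (k + 1) = yhat k + (μ k)⁻¹ • (c (x k) - z k)
  μ_step : ∀ k, ∃ b ∈ Ioc 0 β ∪ {(1 : ℝ)}, μ (k + 1) = b * μ k

end Problem

end

end CompositeALM

set_option linter.unusedSectionVars false

/-! Everything takes place on the epigraph `E` of the value function, which is closed (lsc) and
convex (`convex_valueEpi`). Substituting u = c(x) - z gives M(y) = inf {r + ⟨y, u⟩ | (u, r) ∈ E}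
(`neg_dualFun_le_iff`), and step k of the method minimizes the strongly convex `augHeight` over `E`
up to ε_k. Its exact minimizer P_k yields p_k, the proximal point of -M at ŷ^k, and quadratic growth
gives ‖y^{k+1} - p_k‖ ≤ √(2 ε_k/μ_k) (`exists_proxTrack`). The method is thus an inexact proximal
point iteration on -M, restarted from projections.

The Lyapunov function -M(p_k) + (μ_k/2) dist²(p_k, S), shifted to be nonnegative, decreases by
(μ_{k+1}/2)‖p_{k+1} - p_k‖² up to summable errors (`summable_exact`), whence the summability claims.
At a cluster point, P_k.1 = μ_k(p_k - ŷ^k) tends to the gradient of the penalty, so the supporting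
inequalities pass to the limit as optimality for the penalized dual (`le_of_mapClusterPt`). -/

namespace CompositeALM

/-! ### Projections and quadratic perturbations over a convex set -/

section Abstract

variable {Y : Type*} [NormedAddCommGroup Y] [InnerProductSpace ℝ Y]

/-- The variational inequality characterizing projections onto a convex set. -/
lemma IsProjection.inner_le_zero {S : Set Y} (hS : Convex ℝ S) {a p : Y}
    (h : IsProjection S a p) {q : Y} (hq : q ∈ S) : inner ℝ (a - p) (q - p) ≤ 0 := by
  refine (norm_eq_iInf_iff_real_inner_le_zero hS h.1).1 ?_ q hq
  rw [norm_sub_rev, h.2, Metric.infDist_eq_iInf]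
  simp only [dist_eq_norm]

lemma IsProjection.norm_sub_le {S : Set Y} (hS : Convex ℝ S) {a b p q : Y}
    (hp : IsProjection S a p) (hq : IsProjection S b q) : ‖p - q‖ ≤ ‖a - b‖ := by
  have h1 := hp.inner_le_zero hS hq.1
  have h2 := hq.inner_le_zero hS hp.1
  have h3 : ‖p - q‖ * ‖p - q‖ ≤ ‖a - b‖ * ‖p - q‖ := by
    have h4 := real_inner_le_norm (a - b) (p - q)
    rw [← real_inner_self_eq_norm_mul_norm]
    simp only [inner_sub_left, inner_sub_right] at *
    linarith [real_inner_comm p q]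
  rcases (norm_nonneg (p - q)).eq_or_lt with h | h
  · rw [← h]; exact norm_nonneg _
  · exact le_of_mul_le_mul_right h3 h

/-- The gradient inequality for half the squared distance to a convex set. -/
lemma IsProjection.half_sq_infDist_ge {S : Set Y} (hS : Convex ℝ S) {a b p q : Y}
    (hp : IsProjection S a p) (hq : IsProjection S b q) :
    Metric.infDist a S ^ 2 / 2 + inner ℝ (a - p) (b - a) ≤ Metric.infDist b S ^ 2 / 2 := by
  have h1 := hp.inner_le_zero hS hq.1
  rw [← hp.2, ← hq.2, norm_sub_rev, norm_sub_rev q]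
  have h2 := sq_nonneg ‖(b - q) - (a - p)‖
  rw [norm_sub_sq_real] at h2
  have h3 : inner ℝ (a - p) (b - a) = inner ℝ (a - p) (b - q) - inner ℝ (a - p) (a - p)
      + inner ℝ (a - p) (q - p) := by
    rw [← inner_sub_right, ← inner_add_right]; congr 1; abel
  rw [real_inner_self_eq_norm_sq] at h3
  rw [real_inner_comm] at h2
  linarith

lemma exists_isProjection {Z : Type*} [NormedAddCommGroup Z] {S : Set Z}
    (hS : IsCompact S) (hne : S.Nonempty) (a : Z) :
    ∃ p, IsProjection S a p := by
  obtain ⟨p, hp, h⟩ := hS.exists_infDist_eq_dist hne a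
  exact ⟨p, hp, by rw [h, dist_comm, dist_eq_norm]⟩

/-- The quadratic perturbation `r + ⟨w, u⟩ + ‖u‖² / (2 γ)` of the height function. -/
noncomputable def augHeight (γ : ℝ) (w : Y) (p : Y × ℝ) : ℝ :=
  p.2 + inner ℝ w p.1 + ‖p.1‖ ^ 2 / (2 * γ)

lemma augHeight_combo (γ : ℝ) (w : Y) (p q : Y × ℝ) (t : ℝ) :
    augHeight γ w ((1 - t) • p + t • q) = (1 - t) * augHeight γ w p + t * augHeight γ w q
      - t * (1 - t) * ‖p.1 - q.1‖ ^ 2 / (2 * γ) := by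
  unfold augHeight
  have h : ‖(1 - t) • p.1 + t • q.1‖ ^ 2
      = (1 - t) * ‖p.1‖ ^ 2 + t * ‖q.1‖ ^ 2 - t * (1 - t) * ‖p.1 - q.1‖ ^ 2 := by
    rw [norm_add_sq_real, norm_sub_sq_real, norm_smul, norm_smul, inner_smul_left,
      inner_smul_right, mul_pow, mul_pow, Real.norm_eq_abs, Real.norm_eq_abs, sq_abs, sq_abs]
    simp only [RCLike.conj_to_real]
    ring
  simp only [Prod.fst_add, Prod.snd_add, Prod.smul_fst, Prod.smul_snd, smul_eq_mul, h,
    inner_add_right, inner_smul_right]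
  ring

/-- A strongly convex function that is bounded below on a closed convex set attains its
minimum there. -/
lemma exists_isMinOn_augHeight [CompleteSpace Y] {E : Set (Y × ℝ)} (hc : Convex ℝ E)
    (hcl : IsClosed E) (hne : E.Nonempty) {γ : ℝ} (hγ : 0 < γ) (w : Y)
    (hb : BddBelow (augHeight γ w '' E)) : ∃ p ∈ E, IsMinOn (augHeight γ w) E p := by
  set m := sInf (augHeight γ w '' E)
  have hm : ∀ p ∈ E, m ≤ augHeight γ w p := fun p hp => csInf_le hb (mem_image_of_mem _ hp)
  have hex : ∀ n : ℕ, ∃ p ∈ E, augHeight γ w p < m + 1 / ((n : ℝ) + 1) := by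
    intro n
    obtain ⟨_, ⟨p, hp, rfl⟩, h⟩ := exists_lt_of_csInf_lt (hne.image (augHeight γ w))
      (lt_add_of_pos_right m (Nat.one_div_pos_of_nat (n := n) (α := ℝ)))
    exact ⟨p, hp, h⟩
  choose s hsE hs using hex
  have key : ∀ N n k : ℕ, N ≤ n → N ≤ k →
      dist (s n).1 (s k).1 ≤ Real.sqrt (8 * γ * (1 / ((N : ℝ) + 1))) := by
    intro N n k hn hk
    apply Real.le_sqrt_of_sq_le
    -- Testing the midpoint gives (1/4)‖·‖²/(2γ) ≤ 1/(N+1), hence the constant 8γ.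
    have h1 := hm _ (hc (hsE n) (hsE k) (by norm_num : (0 : ℝ) ≤ 1 - 1 / 2)
      (by norm_num : (0 : ℝ) ≤ 1 / 2) (by norm_num))
    rw [augHeight_combo] at h1
    have h2 : 1 / ((n : ℝ) + 1) ≤ 1 / ((N : ℝ) + 1) := Nat.one_div_le_one_div hn
    have h3 : 1 / ((k : ℝ) + 1) ≤ 1 / ((N : ℝ) + 1) := Nat.one_div_le_one_div hk
    have h4 := hs n
    have h5 := hs k
    have h6 : 1 / 2 * (1 - 1 / 2) * ‖(s n).1 - (s k).1‖ ^ 2 / (2 * γ)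
        ≤ 1 / ((N : ℝ) + 1) := by linarith
    rw [div_le_iff₀ (by positivity)] at h6
    rw [dist_eq_norm]
    linarith
  have hlim0 : Tendsto (fun N : ℕ => Real.sqrt (8 * γ * (1 / ((N : ℝ) + 1)))) atTop (𝓝 0) := by
    have := ((tendsto_one_div_add_atTop_nhds_zero_nat (𝕜 := ℝ)).const_mul (8 * γ)).sqrt
    simpa using this
  have hcau : CauchySeq (fun n => (s n).1) :=
    cauchySeq_of_le_tendsto_0 _ (fun n k N hn hk => key N n k hn hk) hlim0
  obtain ⟨u, hu⟩ := cauchySeq_tendsto_of_complete hcau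
  have hval : Tendsto (fun n => augHeight γ w (s n)) atTop (𝓝 m) := by
    refine tendsto_of_tendsto_of_tendsto_of_le_of_le tendsto_const_nhds ?_
      (fun n => hm _ (hsE n)) (fun n => (hs n).le)
    simpa using (tendsto_one_div_add_atTop_nhds_zero_nat (𝕜 := ℝ)).const_add m
  -- Strong convexity controls only the first component; the height converges because the total
  -- value does.
  have hr : Tendsto (fun n => (s n).2) atTop
      (𝓝 (m - inner ℝ w u - ‖u‖ ^ 2 / (2 * γ))) := by
    have h1 : Tendsto (fun n => inner ℝ w (s n).1) atTop (𝓝 (inner ℝ w u)) :=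
      tendsto_const_nhds.inner hu
    have h2 := (hval.sub h1).sub ((hu.norm.pow 2).div_const (2 * γ))
    refine h2.congr fun n => ?_
    simp only [augHeight]; ring
  have hs' : Tendsto s atTop (𝓝 (u, m - inner ℝ w u - ‖u‖ ^ 2 / (2 * γ))) :=
    hu.prodMk_nhds hr
  refine ⟨_, hcl.mem_of_tendsto hs' (Eventually.of_forall hsE), fun q hq => ?_⟩
  refine le_trans (le_of_eq ?_) (hm q hq)
  simp only [augHeight]; ring

lemma nonneg_of_forall_mul_le {a b : ℝ} (h : ∀ t ∈ Ioo (0 : ℝ) 1, a * t ≤ b) : a ≤ b := by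
  have h1 : Tendsto (fun t : ℝ => a * t) (𝓝[<] 1) (𝓝 (a * 1)) :=
    ((continuous_const.mul continuous_id).tendsto 1).mono_left nhdsWithin_le_nhds
  rw [mul_one] at h1
  refine le_of_tendsto h1 ?_
  filter_upwards [Ioo_mem_nhdsLT (zero_lt_one' ℝ)] with t ht using h t ht

/-- Quadratic growth at a minimizer. -/
lemma augHeight_growth {E : Set (Y × ℝ)} (hc : Convex ℝ E) {γ : ℝ} {w : Y}
    {p : Y × ℝ} (hp : p ∈ E) (hmin : IsMinOn (augHeight γ w) E p) {q : Y × ℝ} (hq : q ∈ E) :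
    augHeight γ w p + ‖p.1 - q.1‖ ^ 2 / (2 * γ) ≤ augHeight γ w q := by
  have : ‖p.1 - q.1‖ ^ 2 / (2 * γ) ≤ augHeight γ w q - augHeight γ w p := by
    -- Compare p with t p + (1 - t) q, divide by 1 - t, and let t → 1.
    refine nonneg_of_forall_mul_le fun t ht => ?_
    have h0 : (0 : ℝ) < 1 - t := by linarith [ht.2]
    have h1 : augHeight γ w p ≤ _ := hmin (hc hp hq ht.1.le h0.le (by ring))
    have h2 := augHeight_combo γ w p q (1 - t)
    rw [sub_sub_cancel] at h2
    rw [h2] at h1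
    refine le_of_mul_le_mul_left ?_ h0
    have : (1 - t) * t * ‖p.1 - q.1‖ ^ 2 / (2 * γ)
      = (1 - t) * (‖p.1 - q.1‖ ^ 2 / (2 * γ) * t) := by ring
    linarith
  linarith

/-- First-order optimality: the shifted multiplier supports `E` at the minimizer. -/
lemma augHeight_support {E : Set (Y × ℝ)} (hc : Convex ℝ E) {γ : ℝ} {w : Y}
    {p : Y × ℝ} (hp : p ∈ E) (hmin : IsMinOn (augHeight γ w) E p) {q : Y × ℝ} (hq : q ∈ E) :
    p.2 + inner ℝ (w + γ⁻¹ • p.1) p.1 ≤ q.2 + inner ℝ (w + γ⁻¹ • p.1) q.1 := by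
  -- The ‖q.1‖² terms on the two sides cancel exactly, leaving an inequality affine in q.
  have h := augHeight_growth hc hp hmin hq
  simp only [augHeight, norm_sub_sq_real] at h
  simp only [inner_add_left, inner_smul_left, RCLike.conj_to_real, real_inner_self_eq_norm_sq]
  have e : (‖p.1‖ ^ 2 - 2 * inner ℝ p.1 q.1 + ‖q.1‖ ^ 2) / (2 * γ)
    = γ⁻¹ * ‖p.1‖ ^ 2 - ‖p.1‖ ^ 2 / (2 * γ) - γ⁻¹ * inner ℝ p.1 q.1
      + ‖q.1‖ ^ 2 / (2 * γ) := by
    rw [← mul_inv_cancel_left₀ (two_ne_zero' ℝ) γ⁻¹]; simp only [div_eq_mul_inv, mul_inv]; ring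
  linarith

end Abstract


/-! ### Summability under perturbed descent -/

lemma Summable.sq_of_nonneg {s : ℕ → ℝ} (hs : Summable s) (h0 : ∀ k, 0 ≤ s k) :
    Summable fun k => s k ^ 2 := by
  refine Summable.of_nonneg_of_le (fun k => sq_nonneg _) (fun k => ?_) (hs.mul_left (∑' k, s k))
  rw [sq]
  exact mul_le_mul_of_nonneg_right (hs.le_tsum k fun j _ => h0 j) (h0 k)

/-- Quasi-Fejér type descent with summable errors forces the decrements to be summable. -/
lemma summable_of_descent {a b s : ℕ → ℝ} (ha : ∀ k, 0 ≤ a k) (hb : ∀ k, 0 ≤ b k)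
    (hs0 : ∀ k, 0 ≤ s k) (hs : Summable s)
    (h : ∀ k, a (k + 1) + b k ≤ (Real.sqrt (a k) + s k) ^ 2) : Summable b := by
  have h1 : ∀ k, Real.sqrt (a k) ≤ Real.sqrt (a 0) + ∑ i ∈ Finset.range k, s i := by
    intro k
    induction k with
    | zero => simp
    | succ k ih =>
      have : Real.sqrt (a (k + 1)) ≤ Real.sqrt (a k) + s k :=
        Real.sqrt_le_iff.2 ⟨add_nonneg (Real.sqrt_nonneg _) (hs0 k), by linarith [h k, hb k]⟩
      rw [Finset.sum_range_succ]
      linarith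
  -- A uniform bound on √(a k) makes the cross terms 2 √(a k) s k summable.
  set A := Real.sqrt (a 0) + ∑' i, s i
  have hA : ∀ k, Real.sqrt (a k) ≤ A := fun k =>
    (h1 k).trans (add_le_add_right (hs.sum_le_tsum _ fun i _ => hs0 i) _)
  have hA0 : 0 ≤ A := (Real.sqrt_nonneg _).trans (hA 0)
  have hs2 := Summable.sq_of_nonneg hs hs0
  set t : ℕ → ℝ := fun k => 2 * A * s k + s k ^ 2
  have ht : Summable t := (hs.mul_left _).add hs2
  have ht0 : ∀ k, 0 ≤ t k := fun k => by
    have := hs0 k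
    positivity
  have h2 : ∀ k, a (k + 1) + b k ≤ a k + t k := fun k => by
    have := h k
    rw [add_sq, Real.sq_sqrt (ha k)] at this
    have h3 := mul_le_mul_of_nonneg_right (hA k) (hs0 k)
    simp only [t]
    linarith
  have h3 : ∀ n, a n + ∑ i ∈ Finset.range n, b i ≤ a 0 + ∑ i ∈ Finset.range n, t i := by
    intro n
    induction n with
    | zero => simp
    | succ n ih =>
      rw [Finset.sum_range_succ, Finset.sum_range_succ]
      linarith [h2 n]
  refine summable_of_sum_range_le (c := a 0 + ∑' i, t i) hb fun n => ?_
  linarith [h3 n, ha n, ht.sum_le_tsum (Finset.range n) fun i _ => ht0 i]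

lemma tendsto_smul_of_summable {Y : Type*} [NormedAddCommGroup Y] [NormedSpace ℝ Y]
    {μ : ℕ → ℝ} (hpos : ∀ k, 0 < μ k) (hanti : Antitone μ) {d : ℕ → Y}
    (h : Summable fun k => μ k * ‖d k‖ ^ 2) : Tendsto (fun k => μ k • d k) atTop (𝓝 0) := by
  have h1 : Tendsto (fun k => Real.sqrt (μ 0 * (μ k * ‖d k‖ ^ 2))) atTop (𝓝 0) := by
    simpa using (h.tendsto_atTop_zero.const_mul (μ 0)).sqrt
  refine squeeze_zero_norm (fun k => Real.le_sqrt_of_sq_le ?_) h1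
  rw [norm_smul, mul_pow, Real.norm_eq_abs, sq_abs, sq, mul_assoc]
  have := hpos k
  exact mul_le_mul_of_nonneg_right (hanti (Nat.zero_le k)) (by positivity)

/-! ### Inexact proximal point iteration with projections -/

section Abstract

variable {Y : Type*} [NormedAddCommGroup Y] [InnerProductSpace ℝ Y]

/-- The iterates `y (k + 1)` track, up to the errors `e k`, the exact proximal points `p k` of
the conjugate function `y ↦ sup {-⟨y, u⟩ - r | (u, r) ∈ E}` at the projections `yhat k`;
`P k ∈ E` is the point at which the supremum defining the conjugate at `p k` is attained. -/
structure ProxTrack (E : Set (Y × ℝ)) (S : Set Y) (μ e : ℕ → ℝ) (y yhat p : ℕ → Y)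
    (P : ℕ → Y × ℝ) : Prop where
  S_convex : Convex ℝ S
  S_compact : IsCompact S
  S_nonempty : S.Nonempty
  μ_pos : ∀ k, 0 < μ k
  μ_anti : Antitone μ
  proj : ∀ k, IsProjection S (y k) (yhat k)
  mem : ∀ k, P k ∈ E
  support : ∀ k, ∀ w ∈ E, (P k).2 + inner ℝ (p k) (P k).1 ≤ w.2 + inner ℝ (p k) w.1
  step : ∀ k, (P k).1 = μ k • (p k - yhat k)
  near : ∀ k, ‖y (k + 1) - p k‖ ≤ e k
  summable : Summable e

lemma exists_proxTrack [CompleteSpace Y] {E : Set (Y × ℝ)} (hc : Convex ℝ E) (hcl : IsClosed E)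
    {S : Set Y} (hS : Convex ℝ S) (hSc : IsCompact S) (hSn : S.Nonempty) {μ ε : ℕ → ℝ}
    (hμ : ∀ k, 0 < μ k) (hanti : Antitone μ) {y yhat : ℕ → Y}
    (hproj : ∀ k, IsProjection S (y k) (yhat k)) {q : ℕ → Y × ℝ} (hq : ∀ k, q k ∈ E)
    (hmin : ∀ k, ∀ w ∈ E, augHeight (μ k) (yhat k) (q k) ≤ augHeight (μ k) (yhat k) w + ε k)
    (hy : ∀ k, y (k + 1) = yhat k + (μ k)⁻¹ • (q k).1)
    (hε : Summable fun k => Real.sqrt (ε k / μ k)) :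
    ∃ e p P, ProxTrack E S μ e y yhat p P := by
  have hex : ∀ k, ∃ w ∈ E, IsMinOn (augHeight (μ k) (yhat k)) E w := fun k =>
    exists_isMinOn_augHeight hc hcl ⟨q k, hq k⟩ (hμ k) _
      ⟨augHeight (μ k) (yhat k) (q k) - ε k, by
        rintro _ ⟨w, hw, rfl⟩
        linarith [hmin k w hw]⟩
  choose P hPE hP using hex
  -- Quadratic growth bounds ‖(P k).1 - (q k).1‖² by 2 μ_k ε_k; the multiplier update divides this
  -- by μ_k².
  refine ⟨fun k => Real.sqrt 2 * Real.sqrt (ε k / μ k), fun k => yhat k + (μ k)⁻¹ • (P k).1, P,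
    hS, hSc, hSn, hμ, hanti, hproj, hPE,
    fun k w hw => augHeight_support hc (hPE k) (hP k) hw, fun k => ?_, fun k => ?_,
    hε.mul_left _⟩
  · simp [smul_smul, (hμ k).ne']
  · rw [hy, add_sub_add_left_eq_sub, ← smul_sub, ← Real.sqrt_mul zero_le_two]
    apply Real.le_sqrt_of_sq_le
    have h1 := augHeight_growth hc (hPE k) (hP k) (hq k)
    have h2 := hmin k _ (hPE k)
    have h3 : ‖(P k).1 - (q k).1‖ ^ 2 / (2 * μ k) ≤ ε k := by linarith
    have h4 := hμ k
    rw [norm_smul, mul_pow, Real.norm_eq_abs, sq_abs, norm_sub_rev]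
    calc (μ k)⁻¹ ^ 2 * ‖(P k).1 - (q k).1‖ ^ 2
        = 2 / μ k * (‖(P k).1 - (q k).1‖ ^ 2 / (2 * μ k)) := by field_simp
      _ ≤ 2 / μ k * ε k := mul_le_mul_of_nonneg_left h3 (by positivity)
      _ = 2 * (ε k / μ k) := by ring

namespace ProxTrack

variable {E : Set (Y × ℝ)} {S : Set Y} {μ e : ℕ → ℝ} {y yhat p : ℕ → Y} {P : ℕ → Y × ℝ}

lemma e_nonneg (h : ProxTrack E S μ e y yhat p P) (k : ℕ) : 0 ≤ e k :=
  (norm_nonneg _).trans (h.near k)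

/-- One error e k pays for replacing p k by y (k + 1), another for comparing their distances to S.
-/
lemma norm_sub_yhat_le (h : ProxTrack E S μ e y yhat p P) (k : ℕ) :
    ‖p k - yhat (k + 1)‖ ≤ Metric.infDist (p k) S + 2 * e k := by
  have h1 := h.near k
  have h2 : ‖yhat (k + 1) - y (k + 1)‖ = _ := (h.proj (k + 1)).2
  have h3 := Metric.infDist_le_infDist_add_dist (s := S) (x := y (k + 1)) (y := p k)
  rw [dist_eq_norm] at h3
  have h4 := norm_sub_le_norm_sub_add_norm_sub (p k) (y (k + 1)) (yhat (k + 1))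
  rw [norm_sub_rev (p k) (y (k + 1)), norm_sub_rev (y (k + 1)) (yhat (k + 1))] at h4
  linarith

lemma summable_exact (h : ProxTrack E S μ e y yhat p P) {r₀ : ℝ} (hr : ((0 : Y), r₀) ∈ E) :
    Summable fun k => μ (k + 1) / 2 * ‖p (k + 1) - p k‖ ^ 2 := by
  -- When `E` is the value epigraph this is the gap r₀ - M(p k), nonnegative by weak duality.
  set v : ℕ → ℝ := fun k => r₀ - (P k).2 - inner ℝ (p k) (P k).1 with hv
  have hv0 : ∀ k, 0 ≤ v k := fun k => by
    have := h.support k _ hr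
    simp only [inner_zero_right] at this
    simp only [hv]; linarith
  set d : ℕ → ℝ := fun k => Metric.infDist (p k) S with hd
  have hd0 : ∀ k, 0 ≤ d k := fun k => Metric.infDist_nonneg
  have hC := Real.sq_sqrt (mul_nonneg zero_le_two (h.μ_pos 0).le)
  set C := Real.sqrt (2 * μ 0)
  have hC0 : 0 ≤ C := Real.sqrt_nonneg _
  refine summable_of_descent (a := fun k => v k + μ k / 2 * d k ^ 2) (s := fun k => C * e k)
    (fun k => ?_) (fun k => ?_) (fun k => mul_nonneg hC0 (h.e_nonneg k))
    (h.summable.mul_left _) (fun k => ?_)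
  · have := h.μ_pos k; have := hv0 k; positivity
  · have := h.μ_pos (k + 1); positivity
  have hμ := h.μ_pos k
  have hμ' := h.μ_pos (k + 1)
  have hanti : μ (k + 1) ≤ μ k := h.μ_anti k.le_succ
  have hanti0 : μ k ≤ μ 0 := h.μ_anti k.zero_le
  have he := h.e_nonneg k
  have ha : 0 ≤ v k + μ k / 2 * d k ^ 2 := by have := hv0 k; positivity
  -- Three-point inequality of the proximal step: support at p k is tested on P (k + 1).
  have h1 : v (k + 1) + μ (k + 1) / 2 * d (k + 1) ^ 2
      + μ (k + 1) / 2 * ‖p (k + 1) - p k‖ ^ 2 ≤ v k + μ (k + 1) / 2 * ‖p k - yhat (k + 1)‖ ^ 2 := by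
    have h2 := h.support k _ (h.mem (k + 1))
    have h3 : d (k + 1) ^ 2 ≤ ‖p (k + 1) - yhat (k + 1)‖ ^ 2 := by
      refine pow_le_pow_left₀ (hd0 _) ?_ 2
      rw [← dist_eq_norm]
      exact Metric.infDist_le_dist_of_mem (h.proj _).1
    have h4 := mul_le_mul_of_nonneg_left h3 (half_pos hμ').le
    have h5 : inner ℝ (p (k + 1)) (P (k + 1)).1 - inner ℝ (p k) (P (k + 1)).1
        = μ (k + 1) / 2 * (‖p (k + 1) - yhat (k + 1)‖ ^ 2 + ‖p (k + 1) - p k‖ ^ 2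
          - ‖p k - yhat (k + 1)‖ ^ 2) := by
      have h6 : p k - yhat (k + 1) = (p (k + 1) - yhat (k + 1)) - (p (k + 1) - p k) := by abel
      rw [← inner_sub_left, h.step, inner_smul_right, h6,
        norm_sub_sq_real (p (k + 1) - yhat (k + 1)), real_inner_comm]
      ring
    simp only [hv]
    linarith
  have h2 : μ (k + 1) / 2 * ‖p k - yhat (k + 1)‖ ^ 2 ≤ μ k / 2 * (d k + 2 * e k) ^ 2 := by
    have := pow_le_pow_left₀ (norm_nonneg _) (h.norm_sub_yhat_le k) 2
    exact mul_le_mul (by linarith) this (by positivity) (by positivity)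
  -- With C² = 2 μ 0, both error terms 2 μ d e and 2 μ e² fit into (√a + C e)².
  have h3 : μ k * d k ≤ C * Real.sqrt (v k + μ k / 2 * d k ^ 2) := by
    rw [← Real.sqrt_mul (by have := h.μ_pos 0; positivity)]
    apply Real.le_sqrt_of_sq_le
    have h4 : 2 * μ 0 * (μ k / 2 * d k ^ 2) ≤ 2 * μ 0 * (v k + μ k / 2 * d k ^ 2) :=
      mul_le_mul_of_nonneg_left (by linarith [hv0 k]) (by linarith)
    have h5 : μ k * (μ k * d k ^ 2) ≤ μ 0 * (μ k * d k ^ 2) :=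
      mul_le_mul_of_nonneg_right hanti0 (by positivity)
    nlinarith
  have h6 := mul_le_mul_of_nonneg_right h3 he
  have h7 : μ k * e k ^ 2 ≤ μ 0 * e k ^ 2 := mul_le_mul_of_nonneg_right hanti0 (by positivity)
  rw [add_sq, Real.sq_sqrt ha, mul_pow, hC]
  nlinarith

lemma summable_sq (h : ProxTrack E S μ e y yhat p P) {r₀ : ℝ} (hr : ((0 : Y), r₀) ∈ E) :
    Summable fun k => μ k * ‖y (k + 1) - y k‖ ^ 2 := by
  -- y 0 is arbitrary; only y (k + 1) tracks a proximal point, namely p k.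
  rw [← summable_nat_add_iff 1]
  have he2 := Summable.sq_of_nonneg h.summable h.e_nonneg
  have hs := (((h.summable_exact hr).mul_left 6).add
    (((summable_nat_add_iff 1).2 he2).mul_left (3 * μ 0))).add (he2.mul_left (3 * μ 0))
  refine Summable.of_nonneg_of_le
    (fun _ => mul_nonneg (h.μ_pos _).le (sq_nonneg _)) (fun k => ?_) hs
  have hμ := h.μ_pos (k + 1)
  have h1 : ‖y (k + 1 + 1) - y (k + 1)‖ ≤ ‖p (k + 1) - p k‖ + e (k + 1) + e k := by
    have h2 : y (k + 1 + 1) - y (k + 1)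
      = (p (k + 1) - p k) + (y (k + 1 + 1) - p (k + 1)) - (y (k + 1) - p k) := by abel
    rw [h2]
    refine (norm_sub_le _ _).trans (add_le_add ((norm_add_le _ _).trans ?_) (h.near k))
    exact add_le_add_right (h.near _) _
  have h2 : ‖y (k + 1 + 1) - y (k + 1)‖ ^ 2
      ≤ 3 * ‖p (k + 1) - p k‖ ^ 2 + 3 * e (k + 1) ^ 2 + 3 * e k ^ 2 := by
    refine (pow_le_pow_left₀ (norm_nonneg _) h1 2).trans ?_
    nlinarith [sq_nonneg (‖p (k + 1) - p k‖ - e (k + 1)), sq_nonneg (‖p (k + 1) - p k‖ - e k),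
      sq_nonneg (e (k + 1) - e k)]
  have h3 := mul_le_mul_of_nonneg_left h2 hμ.le
  have h4 : ∀ j, μ (k + 1) * e j ^ 2 ≤ μ 0 * e j ^ 2 := fun j =>
    mul_le_mul_of_nonneg_right (h.μ_anti (k + 1).zero_le) (sq_nonneg _)
  have h5 := h4 k
  have h6 := h4 (k + 1)
  linarith

lemma summable_sq_yhat (h : ProxTrack E S μ e y yhat p P) {r₀ : ℝ} (hr : ((0 : Y), r₀) ∈ E) :
    Summable fun k => μ k * ‖yhat (k + 1) - yhat k‖ ^ 2 :=
  Summable.of_nonneg_of_le (fun _ => mul_nonneg (h.μ_pos _).le (sq_nonneg _))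
    (fun k => mul_le_mul_of_nonneg_left (pow_le_pow_left₀ (norm_nonneg _)
      ((h.proj (k + 1)).norm_sub_le h.S_convex (h.proj k)) 2) (h.μ_pos k).le)
    (h.summable_sq hr)

/-- Cluster points of the iterates minimize the penalized conjugate function. -/
lemma le_of_mapClusterPt (h : ProxTrack E S μ e y yhat p P) {r₀ : ℝ}
    (hr : ((0 : Y), r₀) ∈ E) {m : ℝ} (hm0 : 0 ≤ m) (hm : Tendsto μ atTop (𝓝 m)) {a : Y}
    (ha : MapClusterPt a atTop y) {b : Y} {s : ℝ}
    (hb : ∀ w ∈ E, -inner ℝ b w.1 - w.2 ≤ s) {w : Y × ℝ} (hw : w ∈ E) :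
    -inner ℝ a w.1 - w.2 + m / 2 * Metric.infDist a S ^ 2
      ≤ s + m / 2 * Metric.infDist b S ^ 2 := by
  obtain ⟨a', ha'⟩ := exists_isProjection h.S_compact h.S_nonempty a
  obtain ⟨b', hb'⟩ := exists_isProjection h.S_compact h.S_nonempty b
  obtain ⟨U, hU, hUa⟩ := mapClusterPt_iff_ultrafilter.1 ha
  -- Convergence of y k is passed to p (k - 1); truncated subtraction matters only at k = 0.
  have hpred : Tendsto (fun k : ℕ => k - 1) U atTop := (tendsto_sub_atTop_nat 1).mono_left hU
  have hpos : ∀ᶠ k in (U : Filter ℕ), k - 1 + 1 = k := by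
    filter_upwards [hU (eventually_ge_atTop 1)] with k hk using Nat.sub_add_cancel hk
  have hyp : Tendsto (fun k => p (k - 1)) U (𝓝 a) := by
    have h1 : Tendsto (fun k => y k - p (k - 1)) U (𝓝 0) := by
      refine squeeze_zero_norm' ?_ (h.summable.tendsto_atTop_zero.comp hpred)
      filter_upwards [hpos] with k hk
      simpa [hk] using h.near (k - 1)
    simpa using hUa.sub h1
  have hyh : Tendsto yhat U (𝓝 a') := by
    rw [tendsto_iff_norm_sub_tendsto_zero] at hUa ⊢
    exact squeeze_zero (fun k => norm_nonneg _)
      (fun k => (h.proj k).norm_sub_le h.S_convex ha') hUa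
  have hμ : Tendsto (fun k => μ (k - 1)) U (𝓝 m) := hm.comp hpred
  -- (P (k - 1)).1 involves yhat (k - 1), whose limit along U is unknown; it is exchanged for yhat k
  -- at the cost of μ (k - 1) • (yhat k - yhat (k - 1)) → 0.
  have hP : Tendsto (fun k => (P (k - 1)).1) U (𝓝 (m • (a - a'))) := by
    have h1 := (tendsto_smul_of_summable h.μ_pos h.μ_anti (h.summable_sq_yhat hr)).comp hpred
    have h2 := (hμ.smul (hyp.sub hyh)).add h1
    rw [add_zero] at h2
    refine h2.congr' ?_
    filter_upwards [hpos] with k hk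
    rw [h.step, Function.comp_apply, hk, ← smul_add]
    congr 1; abel
  have hlim : Tendsto (fun k => -inner ℝ (p (k - 1)) w.1 - w.2
      + inner ℝ (p (k - 1) - b) (P (k - 1)).1) U
      (𝓝 (-inner ℝ a w.1 - w.2 + inner ℝ (a - b) (m • (a - a')))) :=
    (((hyp.inner tendsto_const_nhds).neg).sub tendsto_const_nhds).add
      ((hyp.sub tendsto_const_nhds).inner hP)
  -- Adding the support inequality to the bound at b, tested on P (k - 1), eliminates its height,
  -- whose convergence is not known.
  have h1 := le_of_tendsto hlim (Eventually.of_forall fun k => by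
    have h2 := h.support (k - 1) w hw
    have h3 := hb _ (h.mem (k - 1))
    rw [inner_sub_left]
    show _ ≤ s
    linarith)
  have h4 := mul_le_mul_of_nonneg_left (ha'.half_sq_infDist_ge h.S_convex hb') hm0
  have h5 : inner ℝ (a - b) (m • (a - a')) = - (m * inner ℝ (a - a') (b - a)) := by
    rw [inner_smul_right, real_inner_comm, ← neg_sub b a, inner_neg_right]; ring
  linarith

end ProxTrack

end Abstract


/-! ### Value function epigraph and duality -/

section Problem

variable {X Y : Type*} [NormedAddCommGroup X] [InnerProductSpace ℝ X]
  [NormedAddCommGroup Y] [InnerProductSpace ℝ Y]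
  {f : X → ℝ} {g : Y → EReal} {c : X → Y}

/-- The epigraph of the value function. -/
def valueEpi (f : X → ℝ) (g : Y → EReal) (c : X → Y) : Set (Y × ℝ) :=
  {w | valueFun f g c w.1 ≤ (w.2 : EReal)}

lemma Proper.exists_coe {E : Type*} {φ : E → EReal} (h : Proper φ) {v : E} (hv : φ v < ⊤) :
    ∃ r : ℝ, φ v = r :=
  ⟨(φ v).toReal, (EReal.coe_toReal hv.ne (h.2 v)).symm⟩

lemma exists_of_valueFun_lt (hg : Proper g) {u : Y} {s : ℝ}
    (h : valueFun f g c u < s) : ∃ x : X, ∃ r : ℝ, g (c x - u) = r ∧ f x + r < s := by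
  obtain ⟨x, hx⟩ := iInf_lt_iff.1 h
  have hlt : g (c x - u) < ⊤ := by
    refine lt_top_iff_ne_top.2 fun h1 => ?_
    rw [h1, EReal.coe_add_top] at hx
    exact not_top_lt hx
  obtain ⟨r, hr⟩ := hg.exists_coe hlt
  refine ⟨x, r, hr, ?_⟩
  rw [hr] at hx
  exact_mod_cast hx

lemma mem_valueEpi_of_eq {x : X} {v : Y} {r : ℝ} (h : g v = r) :
    (c x - v, f x + r) ∈ valueEpi f g c := by
  refine (iInf_le (fun x' => (f x' : EReal) + g (c x' - (c x - v))) x).trans ?_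
  simp only [sub_sub_cancel, h]
  norm_cast

/-- A continuous lower bound in terms of feasible pairs extends to the epigraph. -/
lemma le_of_mem_valueEpi (hg : Proper g) {h : Y → ℝ} {a : ℝ}
    (H : ∀ (x : X) (v : Y) (r : ℝ), g v = r → a ≤ f x + r + h (c x - v))
    {w : Y × ℝ} (hw : w ∈ valueEpi f g c) : a ≤ w.2 + h w.1 := by
  refine le_of_forall_pos_le_add fun δ hδ => ?_
  have h1 : valueFun f g c w.1 < ((w.2 + δ : ℝ) : EReal) :=
    lt_of_le_of_lt hw (by exact_mod_cast lt_add_of_pos_right _ hδ)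
  obtain ⟨x, r, hr, hlt⟩ := exists_of_valueFun_lt hg h1
  have h2 := H x _ r hr
  rw [sub_sub_cancel] at h2
  linarith

/-- Combine δ-optimal points for u and u': the convexity defect of c lies in `hzn g`, so adding it
to the argument does not raise g. The slack δ is needed because the infima may not be attained. -/
lemma FullyConvexComposite.convex_valueEpi (hP : FullyConvexComposite f g c) :
    Convex ℝ (valueEpi f g c) := by
  rintro ⟨u, r⟩ hu ⟨u', r'⟩ hu' s t hs ht hst
  have hg := hP.g_proper
  obtain rfl : t = 1 - s := by linarith
  change valueFun f g c (s • u + (1 - s) • u') ≤ ((s * r + (1 - s) * r' : ℝ) : EReal)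
  rw [← EReal.le_of_forall_lt_iff_le]
  intro q hq
  rw [EReal.coe_lt_coe_iff] at hq
  set δ := q - (s * r + (1 - s) * r') with hδ
  have hδ0 : 0 < δ := sub_pos.2 hq
  have h1 : valueFun f g c u < ((r + δ : ℝ) : EReal) :=
    lt_of_le_of_lt hu (by exact_mod_cast lt_add_of_pos_right _ hδ0)
  have h2 : valueFun f g c u' < ((r' + δ : ℝ) : EReal) :=
    lt_of_le_of_lt hu' (by exact_mod_cast lt_add_of_pos_right _ hδ0)
  obtain ⟨x, a, ha, hxa⟩ := exists_of_valueFun_lt hg h1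
  obtain ⟨x', a', ha', hxa'⟩ := exists_of_valueFun_lt hg h2
  have h3 : g (s • (c x - u) + (1 - s) • (c x' - u')) ≤ ((s * a + (1 - s) * a' : ℝ) : EReal) :=
    hP.g_convex (x := (c x - u, a)) ha.le (y := (c x' - u', a')) ha'.le hs ht hst
  have h4 := hP.c_convex x x' s ⟨hs, by linarith⟩ _ (h3.trans_lt (EReal.coe_lt_top _))
  have h5 : s • (c x - u) + (1 - s) • (c x' - u')
      + (c (s • x + (1 - s) • x') - s • c x - (1 - s) • c x')
      = c (s • x + (1 - s) • x') - (s • u + (1 - s) • u') := by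
    rw [smul_sub, smul_sub]; abel
  rw [h5] at h4
  refine (iInf_le _ (s • x + (1 - s) • x')).trans
    ((add_le_add_right (h4.trans h3) _).trans ?_)
  have h6 := hP.f_convex.2 (mem_univ x) (mem_univ x') hs ht hst
  simp only [smul_eq_mul] at h6
  rw [← EReal.coe_add, EReal.coe_le_coe_iff]
  have h7 := mul_le_mul_of_nonneg_left hxa.le hs
  have h8 := mul_le_mul_of_nonneg_left hxa'.le ht
  linarith

lemma isClosed_valueEpi (h : LowerSemicontinuous (valueFun f g c)) :
    IsClosed (valueEpi f g c) :=
  h.isClosed_epigraph.preimage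
    (continuous_fst.prodMk (continuous_coe_real_ereal.comp continuous_snd))

lemma FullyConvexComposite.exists_zero_mem_valueEpi (hP : FullyConvexComposite f g c) :
    ∃ r : ℝ, ((0 : Y), r) ∈ valueEpi f g c := by
  obtain ⟨x, hx, -⟩ := hP.exists_solution
  have hlt : g (c x) < ⊤ := by
    refine lt_top_iff_ne_top.2 fun h1 => ?_
    rw [objective, h1, EReal.coe_add_top] at hx
    exact lt_irrefl _ hx
  obtain ⟨r, hr⟩ := hP.g_proper.exists_coe hlt
  exact ⟨f x + r, by simpa using mem_valueEpi_of_eq (f := f) (c := c) (x := x) hr⟩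

/-- Conjugacy -M(y) = V*(-y), in a form that needs only real arithmetic on the epigraph. -/
lemma neg_dualFun_le_iff (hg : Proper g) {y : Y} {s : ℝ} :
    -dualFun f g c y ≤ (s : EReal) ↔ ∀ w ∈ valueEpi f g c, -inner ℝ y w.1 - w.2 ≤ s := by
  rw [EReal.neg_le, ← EReal.coe_neg]
  constructor
  · intro h w hw
    have := le_of_mem_valueEpi hg (h := fun u => inner ℝ y u) (a := -s) (fun x v r hr => by
      have h1 : ((-s : ℝ) : EReal) ≤ (f x : EReal) + ((r : EReal) + (inner ℝ y (c x - v) : ℝ)) :=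
        (h.trans (iInf_le _ x)).trans (add_le_add_right ((iInf_le _ v).trans (by rw [hr])) _)
      rw [add_assoc]
      exact_mod_cast h1) hw
    linarith
  · intro h
    refine le_iInf fun x => ?_
    have h1 : ((-s - f x : ℝ) : EReal)
        ≤ ⨅ z : Y, (g z + ((inner ℝ y (c x - z) : ℝ) : EReal)) := by
      refine le_iInf fun v => ?_
      by_cases hv : g v < ⊤
      · obtain ⟨r, hr⟩ := hg.exists_coe hv
        have h2 := h _ (mem_valueEpi_of_eq (f := f) (c := c) (x := x) hr)
        rw [hr, ← EReal.coe_add, EReal.coe_le_coe_iff]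
        simp only at h2
        linarith
      · rw [not_lt_top_iff.1 hv, EReal.top_add_coe]
        exact le_top
    calc ((-s : ℝ) : EReal) = (f x : EReal) + ((-s - f x : ℝ) : EReal) := by
          rw [← EReal.coe_add]; congr 1; ring
      _ ≤ _ := add_le_add_right h1 _

lemma penalizedDual_le_iff (hg : Proper g) {S : Set Y} {m : ℝ} {y : Y} {s : ℝ} :
    penalizedDual f g c S m y ≤ (s : EReal) ↔ ∀ w ∈ valueEpi f g c,
      -inner ℝ y w.1 - w.2 + m / 2 * Metric.infDist y S ^ 2 ≤ s := by
  unfold penalizedDual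
  rw [← EReal.le_sub_iff_add_le (Or.inl (EReal.coe_ne_bot _)) (Or.inl (EReal.coe_ne_top _)),
    ← EReal.coe_sub, neg_dualFun_le_iff hg]
  simp only [le_sub_iff_add_le]

/-- -M is a supremum of affine functions. For dist², the gradient inequalities at the combined point
are averaged and their linear terms cancel. -/
lemma convexFun_penalizedDual (hg : Proper g) {S : Set Y} (hS : Convex ℝ S)
    (hSc : IsCompact S) (hSn : S.Nonempty) {m : ℝ} (hm : 0 ≤ m) :
    ConvexFun (penalizedDual f g c S m) := by
  rintro ⟨y, r⟩ hy ⟨y', r'⟩ hy' s t hs ht hst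
  simp only [mem_ofPred_eq, Prod.smul_mk, Prod.mk_add_mk, penalizedDual_le_iff hg] at hy hy' ⊢
  intro w hw
  obtain ⟨p, hp⟩ := exists_isProjection hSc hSn y
  obtain ⟨p', hp'⟩ := exists_isProjection hSc hSn y'
  obtain ⟨q, hq⟩ := exists_isProjection hSc hSn (s • y + t • y')
  have h1 := hq.half_sq_infDist_ge hS hp
  have h2 := hq.half_sq_infDist_ge hS hp'
  set a := s • y + t • y' with ha
  have h0 : s * inner ℝ (a - q) (y - a) + t * inner ℝ (a - q) (y' - a) = 0 := by
    rw [← inner_smul_right, ← inner_smul_right, ← inner_add_right]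
    have : s • (y - a) + t • (y' - a) = 0 := by
      rw [smul_sub, smul_sub, sub_add_sub_comm, ← add_smul, hst, one_smul, ← ha, sub_self]
    rw [this, inner_zero_right]
  have h3 := mul_le_mul_of_nonneg_left h1 hs
  have h4 := mul_le_mul_of_nonneg_left h2 ht
  have h5 : Metric.infDist a S ^ 2 ≤ s * Metric.infDist y S ^ 2 + t * Metric.infDist y' S ^ 2 := by
    obtain rfl : t = 1 - s := by linarith
    linarith
  have h6 := mul_le_mul_of_nonneg_left h5 (div_nonneg hm zero_le_two)
  have h7 := mul_le_mul_of_nonneg_left (hy w hw) hs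
  have h8 := mul_le_mul_of_nonneg_left (hy' w hw) ht
  have h9 : inner ℝ a w.1 = s * inner ℝ y w.1 + t * inner ℝ y' w.1 := by
    rw [ha, inner_add_left, inner_smul_left, inner_smul_left]; simp
  have h10 : w.2 = s * w.2 + t * w.2 := by rw [← add_mul, hst, one_mul]
  rw [smul_eq_mul, smul_eq_mul, h9]
  linarith

/-! ### The method as approximate minimization over the epigraph -/

namespace IsSafeguardedALM

variable {S : Set Y} {β : ℝ} {μ ε : ℕ → ℝ} {x : ℕ → X} {z y yhat : ℕ → Y}

lemma μ_pos (h : IsSafeguardedALM f g c S β μ ε x z y yhat) (k : ℕ) : 0 < μ k := by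
  induction k with
  | zero => exact h.μ_zero_pos
  | succ k ih =>
    obtain ⟨b, hb, h1⟩ := h.μ_step k
    rw [h1]
    rcases hb with hb | rfl
    · exact mul_pos hb.1 ih
    · rwa [one_mul]

lemma antitone_μ (h : IsSafeguardedALM f g c S β μ ε x z y yhat) : Antitone μ := by
  refine antitone_nat_of_succ_le fun k => ?_
  obtain ⟨b, hb, h1⟩ := h.μ_step k
  rw [h1]
  refine mul_le_of_le_one_left (h.μ_pos k).le ?_
  rcases hb with hb | rfl
  · exact hb.2.trans h.β_mem.2.le
  · exact le_rfl

/-- The primal iterates are approximate minimizers of the augmented value function. -/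
lemma exists_augHeight_le (hg : Proper g) (h : IsSafeguardedALM f g c S β μ ε x z y yhat)
    (k : ℕ) : ∃ r : ℝ, (c (x k) - z k, r) ∈ valueEpi f g c ∧ ∀ w ∈ valueEpi f g c,
      augHeight (μ k) (yhat k) (c (x k) - z k, r) ≤ augHeight (μ k) (yhat k) w + ε k := by
  have hμ := h.μ_pos k
  obtain ⟨hlt, hmin⟩ := h.z_step k
  have hz : g (z k) < ⊤ := by
    refine lt_top_iff_ne_top.2 fun h1 => ?_
    simp only [h1, EReal.top_add_coe] at hlt
    exact lt_irrefl _ hlt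
  obtain ⟨r, hr⟩ := hg.exists_coe hz
  refine ⟨f (x k) + r, mem_valueEpi_of_eq hr, fun w hw => ?_⟩
  set θ : Y → ℝ := fun u => inner ℝ (yhat k) u + ‖u‖ ^ 2 / (2 * μ k) with hθ
  -- Completing the square: the proximal objective is the inner objective of the augmented
  -- Lagrangian plus a constant, so z k attains that infimum.
  have hsq : ∀ v : Y, ‖v - (c (x k) + μ k • yhat k)‖ ^ 2 / (2 * μ k)
      = θ (c (x k) - v) + μ k / 2 * ‖yhat k‖ ^ 2 := by
    intro v
    have h1 : v - (c (x k) + μ k • yhat k) = -((c (x k) - v) + μ k • yhat k) := by abel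
    rw [h1, norm_neg, norm_add_sq_real, inner_smul_right, norm_smul, mul_pow,
      Real.norm_eq_abs, sq_abs, real_inner_comm]
    simp only [hθ]
    field_simp
    ring
  have h1 : ((r + θ (c (x k) - z k) : ℝ) : EReal)
      ≤ ⨅ v : Y, (g v + ((θ (c (x k) - v) : ℝ) : EReal)) := by
    refine le_iInf fun v => ?_
    by_cases hv : g v < ⊤
    · obtain ⟨r', hr'⟩ := hg.exists_coe hv
      have h2 := hmin v
      simp only [hr, hr', hsq] at h2 ⊢
      norm_cast at h2 ⊢
      linarith
    · rw [not_lt_top_iff.1 hv, EReal.top_add_coe]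
      exact le_top
  have h2 : ((f (x k) + (r + θ (c (x k) - z k)) : ℝ) : EReal)
      ≤ augLagrangian f g c (μ k) (x k) (yhat k) := by
    rw [EReal.coe_add]
    exact add_le_add_right h1 _
  have h3 := le_of_mem_valueEpi hg (h := fun u => θ u + ε k)
    (a := f (x k) + (r + θ (c (x k) - z k))) (fun x' v r' hr' => by
      have h4 : augLagrangian f g c (μ k) x' (yhat k)
          ≤ ((f x' + (r' + θ (c x' - v)) : ℝ) : EReal) := by
        refine (add_le_add_right (iInf_le _ v) _).trans ?_
        rw [hr']
        norm_cast
      have h5 := (h2.trans (h.x_step k)).trans (add_le_add_left ((iInf_le _ x').trans h4) _)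
      rw [← EReal.coe_add, EReal.coe_le_coe_iff] at h5
      linarith) hw
  simp only [augHeight]
  simp only [hθ] at h3
  linarith

end IsSafeguardedALM

end Problem

end CompositeALM

/-! ### Assembly -/

open CompositeALM in
theorem lemma5p2
    {X Y : Type*}
    [NormedAddCommGroup X] [InnerProductSpace ℝ X] [FiniteDimensional ℝ X]
    [NormedAddCommGroup Y] [InnerProductSpace ℝ Y] [FiniteDimensional ℝ Y]
    (f : X → ℝ) (g : Y → EReal) (c : X → Y)
    (hP : CompositeALM.FullyConvexComposite f g c)
    (hV_proper : CompositeALM.Proper (CompositeALM.valueFun f g c))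
    (hV_lsc : LowerSemicontinuous (CompositeALM.valueFun f g c))
    (S : Set Y) (β : ℝ) (μ ε : ℕ → ℝ) (x : ℕ → X) (z y yhat : ℕ → Y)
    (hALM : CompositeALM.IsSafeguardedALM f g c S β μ ε x z y yhat)
    (hε : Summable (fun k => Real.sqrt (ε k / μ k))) :
    Summable (fun k => μ k * ‖y (k + 1) - y k‖ ^ 2) ∧
    Summable (fun k => μ k * ‖yhat (k + 1) - yhat k‖ ^ 2) ∧
    Tendsto (fun k => μ k • (y (k + 1) - y k)) atTop (𝓝 0) ∧
    Tendsto (fun k => μ k • (yhat (k + 1) - yhat k)) atTop (𝓝 0) ∧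
    ∃ μlim : ℝ, 0 ≤ μlim ∧ Antitone μ ∧ Tendsto μ atTop (𝓝 μlim) ∧
      CompositeALM.ConvexFun (CompositeALM.penalizedDual f g c S μlim) ∧
      ∀ ytilde : Y, MapClusterPt ytilde atTop y →
        CompositeALM.IsSolution (CompositeALM.penalizedDual f g c S μlim) ytilde := by
  have : CompleteSpace Y := FiniteDimensional.complete ℝ Y
  have hg := hP.g_proper
  obtain ⟨r₀, hr₀⟩ := hP.exists_zero_mem_valueEpi
  choose r hr hmin using hALM.exists_augHeight_le hg
  obtain ⟨e, p, P, hT⟩ := exists_proxTrack hP.convex_valueEpi (isClosed_valueEpi hV_lsc)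
    hALM.S_convex hALM.S_compact hALM.S_nonempty hALM.μ_pos hALM.antitone_μ hALM.yhat_step
    hr hmin hALM.y_step hε
  have hy := hT.summable_sq hr₀
  have hyhat := hT.summable_sq_yhat hr₀
  have hlim := tendsto_atTop_ciInf hALM.antitone_μ
    ⟨0, by rintro _ ⟨k, rfl⟩; exact (hALM.μ_pos k).le⟩
  have hlim0 : 0 ≤ ⨅ k, μ k := le_ciInf fun k => (hALM.μ_pos k).le
  refine ⟨hy, hyhat, tendsto_smul_of_summable hALM.μ_pos hALM.antitone_μ hy,
    tendsto_smul_of_summable hALM.μ_pos hALM.antitone_μ hyhat, ⨅ k, μ k, hlim0,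
    hALM.antitone_μ, hlim,
    convexFun_penalizedDual hg hALM.S_convex hALM.S_compact hALM.S_nonempty hlim0,
    fun a ha => ?_⟩
  have hle : ∀ (b : Y) (s : ℝ), -dualFun f g c b ≤ (s : EReal) →
      penalizedDual f g c S (⨅ k, μ k) a
        ≤ ((s + (⨅ k, μ k) / 2 * Metric.infDist b S ^ 2 : ℝ) : EReal) := fun b s hb =>
    (penalizedDual_le_iff hg).2 fun w hw =>
      hT.le_of_mapClusterPt hr₀ hlim0 hlim ha ((neg_dualFun_le_iff hg).1 hb) hw
  -- The proximal point p 0 has finite dual value, so comparison with it makes the objective at a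
  -- less than ∞.
  refine ⟨(hle (p 0) (-inner ℝ (p 0) (P 0).1 - (P 0).2)
    ((neg_dualFun_le_iff hg).2 fun w hw => ?_)).trans_lt (EReal.coe_lt_top _), fun b => ?_⟩
  · linarith [hT.support 0 w hw]
  · unfold penalizedDual at hle ⊢
    induction hb : -dualFun f g c b with
    -- Impossible: feasibility gives -M(b) ≥ -r₀.
    | bot =>
      have h1 : -dualFun f g c b ≤ ((-r₀ - 1 : ℝ) : EReal) := by rw [hb]; exact bot_le
      have h2 := (neg_dualFun_le_iff hg).1 h1 _ hr₀
      simp only [inner_zero_right] at h2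
      linarith
    | top => rw [EReal.top_add_coe]; exact le_top
    | coe s => exact_mod_cast hle b s hb.le
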